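/- Let $A:D(A)\to H$ be a positive definite self-adjoint operator with compact inverse in an infinite-dimensional real Hilbert space $H$, let $\lambda_1\le\lambda_2\le\cdots$ be its eigenvalues and $\{e_n\}_{n\ge1}$ a corresponding orthonormal base of eigenvectors. For $s\in\mathbb R$ let $A^s u:=\sum_n\lambda_n^s u_ne_n$ for $u=\sum_n u_ne_n$, and let $H^s$ be the completion of the finite linear combinations of the $e_n$ in the norm $\|u\|_{H^s}^2:=\sum_n\lambda_n^su_n^2$. Let $\gamma\ge0$, $g\in H$, and let $F:H\to H$ be globally bounded and globally Lipschitz continuous, i.e. there are constants $M,L$ with $$\|F(u)\|_H\le M,\qquad \|F(u_1)-F(u_2)\|_H\le L\|u_1-u_2\|_H,\qquad u,u_1,u_2\in H .$$ For $T>0$, a solution on $[0,T]$ of $$\partial_tA^{-\gamma}u+Au+F(u)=g$$ is a function $u\in C([0,T];H^{-\gamma})\cap L^2(0,T;H^1)$ such that, for every $\varphi\in C_0^\infty(0,T;H^2)$, $$-\int_0^T(u(t),A^{-\gamma}\partial_t\varphi(t))\,dt+\int_0^T(u(t),A\varphi(t))\,dt=\int_0^T(g-F(u(t)),\varphi(t))\,dt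 ,$$ where $(\cdot,\cdot)$ is the inner product of $H$ (extended by duality). Then for every $\beta>0$ there is a constant $C_\beta>0$ such that for every $T>0$, any two solutions $u_1,u_2$ on $[0,T]$ and every $t\in(0,1]$ with $t\le T$, one has $u_1(t)-u_2(t)\in H^{2-\beta}$ and $$\|u_1(t)-u_2(t)\|_{H^{2-\beta}}\le C_\beta\,t^{-1}\,\|u_1(0)-u_2(0)\|_{H^{-\gamma}} .$$ The constant $C_\beta$ does not depend on $u_1$, $u_2$ (nor on $T$). -/

import Mathlib

open MeasureTheory Set
open scoped ContDiff

noncomputable section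

/-- A positive definite self-adjoint (in general unbounded) operator `op : D(op) → H` with compact
inverse. Self-adjointness (`op† = op`) includes density of the domain. -/
structure PosOperator (H : Type*) [NormedAddCommGroup H] [InnerProductSpace ℝ H]
    [CompleteSpace H] where
  op : H →ₗ.[ℝ] H
  selfAdjoint : IsSelfAdjoint op
  posDef : ∀ x : op.domain, x ≠ 0 → 0 < inner ℝ (op x) (x : H)
  compactInverse : ∃ K : H →L[ℝ] H, IsCompactOperator K ∧
    (∀ y : H, ∃ h : K y ∈ op.domain, op ⟨K y, h⟩ = y) ∧ (∀ x : op.domain, K (op x) = x)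

/-- The eigenvalues of `A`, enumerated in non-decreasing order, with a corresponding orthonormal
base of eigenvectors. -/
structure EigenBasis {H : Type*} [NormedAddCommGroup H] [InnerProductSpace ℝ H]
    [CompleteSpace H] (A : PosOperator H) where
  e : HilbertBasis ℕ ℝ H
  lam : ℕ → ℝ
  mono : Monotone lam
  mem_domain : ∀ n, e n ∈ A.op.domain
  eigen : ∀ n, A.op ⟨e n, mem_domain n⟩ = lam n • e n

namespace EigenBasis

variable {H : Type*} [NormedAddCommGroup H] [InnerProductSpace ℝ H] [CompleteSpace H]
  {A : PosOperator H} (E : EigenBasis A)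

theorem lam_pos (n : ℕ) : 0 < E.lam n := by
  have hne : (⟨E.e n, E.mem_domain n⟩ : A.op.domain) ≠ 0 := by
    intro h
    have h0 : E.e n = 0 := congrArg Subtype.val h
    have h1 : ‖E.e n‖ = 1 := E.e.orthonormal.1 n
    rw [h0, norm_zero] at h1
    exact zero_ne_one h1
  have h := A.posDef _ hne
  rw [E.eigen n, real_inner_smul_left, real_inner_self_eq_norm_sq, E.e.orthonormal.1 n] at h
  simpa using h

/-- The fractional power `A ^ s`, acting on the Fourier coefficients: `u n ↦ lam n ^ s * u n`. -/
def pow (s : ℝ) (a : ℕ → ℝ) : ℕ → ℝ := fun n => E.lam n ^ s * a n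

/-- The sequences `a` of Fourier coefficients with `A ^ (s / 2) a` square summable. -/
def HsSubmodule (s : ℝ) : Submodule ℝ (ℕ → ℝ) where
  carrier := {a | Memℓp (E.pow (s / 2) a) 2}
  add_mem' := by
    intro a b ha hb
    have h : E.pow (s / 2) (a + b) = E.pow (s / 2) a + E.pow (s / 2) b := by
      funext n; simp [pow, mul_add]
    simp only [mem_ofPred_eq] at *
    rw [h]
    exact ha.add hb
  zero_mem' := by
    have h : E.pow (s / 2) 0 = 0 := by
      funext n; simp [pow]
    simp only [mem_ofPred_eq]
    rw [h]
    exact zero_memℓp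
  smul_mem' := by
    intro c a ha
    have h : E.pow (s / 2) (c • a) = c • E.pow (s / 2) a := by
      funext n; simp only [pow, Pi.smul_apply, smul_eq_mul]; ring
    simp only [mem_ofPred_eq] at *
    rw [h]
    exact ha.const_smul c

/-- The space `H ^ s`, for any real `s`: the completion of the finite linear combinations of the
eigenvectors in the norm `‖u‖² = ∑ lam n ^ s * u n ^ 2`, realized as the space of all sequences of
Fourier coefficients for which this norm is finite. -/
def Hs (s : ℝ) : Type := E.HsSubmodule s

instance (s : ℝ) : AddCommGroup (E.Hs s) := inferInstanceAs (AddCommGroup (E.HsSubmodule s))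

instance (s : ℝ) : Module ℝ (E.Hs s) := inferInstanceAs (Module ℝ (E.HsSubmodule s))

/-- The Fourier coefficients of an element of `H ^ s`. They identify elements of different spaces
of the scale. -/
def coeff {s : ℝ} (u : E.Hs s) : ℕ → ℝ := u.1

/-- The map `u ↦ A ^ (s / 2) u` from `H ^ s` to square summable sequences. -/
def toL2 (s : ℝ) : E.Hs s →ₗ[ℝ] lp (fun _ : ℕ => ℝ) 2 where
  toFun u := ⟨E.pow (s / 2) (E.coeff u), u.2⟩
  map_add' := by
    intro u v
    ext n
    exact mul_add (E.lam n ^ (s / 2)) (u.1 n) (v.1 n)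
  map_smul' := by
    intro c u
    ext n
    exact mul_left_comm (E.lam n ^ (s / 2)) c (u.1 n)

theorem toL2_injective (s : ℝ) : Function.Injective (E.toL2 s) := by
  intro u v h
  refine Subtype.ext (funext fun n => ?_)
  have hn : E.lam n ^ (s / 2) * u.1 n = E.lam n ^ (s / 2) * v.1 n :=
    congrFun (congrArg Subtype.val h) n
  exact mul_left_cancel₀ (Real.rpow_pos_of_pos (E.lam_pos n) _).ne' hn

/-- The norm `‖u‖_{H ^ s} = ‖A ^ (s / 2) u‖`. -/
instance (s : ℝ) : NormedAddCommGroup (E.Hs s) :=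
  NormedAddCommGroup.induced (E.Hs s) (lp (fun _ : ℕ => ℝ) 2) (E.toL2 s) (E.toL2_injective s)

instance (s : ℝ) : NormedSpace ℝ (E.Hs s) :=
  NormedSpace.induced ℝ (E.Hs s) (lp (fun _ : ℕ => ℝ) 2) (E.toL2 s)

theorem norm_sq_eq {s : ℝ} (u : E.Hs s) :
    ‖u‖ ^ 2 = ∑' n, E.lam n ^ s * E.coeff u n ^ 2 := by
  have h1 : ‖u‖ ^ 2 = ‖E.toL2 s u‖ ^ 2 := rfl
  have h2 := lp.norm_rpow_eq_tsum (p := 2) (by norm_num) (E.toL2 s u)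
  norm_num at h2
  rw [h1, h2]
  refine tsum_congr fun n => ?_
  have h3 : (E.toL2 s u) n = E.lam n ^ (s / 2) * E.coeff u n := rfl
  rw [h3, mul_pow, ← Real.rpow_natCast, ← Real.rpow_mul (E.lam_pos n).le]
  congr 2
  push_cast
  ring

/-- The element `∑ a n • e n` of `H` with Fourier coefficients `a` (for square summable `a`). -/
def toH (a : ℕ → ℝ) : H := ∑' n, a n • E.e n

/-- The inner product of `H` in terms of Fourier coefficients, extended to the duality between
`H ^ (-s)` and `H ^ s`. -/
def pairing (a b : ℕ → ℝ) : ℝ := ∑' n, a n * b n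

/-- `u` is a (distributional) solution on `[0, T]` of `∂ₜ A ^ (-γ) u + A u + F(u) = g`:
`u ∈ C(0, T; H ^ (-γ)) ∩ L²(0, T; H ^ 1)`, and the integral identity holds for all test functions
`φ ∈ C₀^∞(0, T; H ^ 2)`. The initial value is `u 0`; values outside `[0, T]` play no role. -/
structure IsSolution (γ : ℝ) (F : H → H) (g : H) (T : ℝ) (u : ℝ → E.Hs (-γ)) : Prop where
  continuousOn : ContinuousOn u (Icc 0 T)
  memL2 : ∃ w : ℝ → E.Hs 1, MemLp w 2 (volume.restrict (Ioo 0 T)) ∧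
    ∀ᵐ t ∂(volume.restrict (Ioo 0 T)), E.coeff (w t) = E.coeff (u t)
  weak : ∀ φ : ℝ → E.Hs 2, ContDiff ℝ ∞ φ → HasCompactSupport φ → tsupport φ ⊆ Ioo 0 T →
    -(∫ t in Ioo 0 T, pairing (E.coeff (u t)) (E.pow (-γ) (E.coeff (deriv φ t))))
        + ∫ t in Ioo 0 T, pairing (E.coeff (u t)) (E.pow 1 (E.coeff (φ t)))
      = ∫ t in Ioo 0 T, inner ℝ (g - F (E.toH (E.coeff (u t)))) (E.toH (E.coeff (φ t)))

end EigenBasis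

end

/-! Testing the equation with `χ(t) e_n` decouples it into scalar equations x' + λ_n^(1+γ) x = λ_n^γ
(g - F(u), e_n), solved by variation of constants (`coeff_eq`). In the difference of two solutions g
cancels. Weight the n-th coefficient by λ_n^q with q < 1 and put a = (q+γ)/(1+γ) < 1. Parabolic
smoothing bounds λ^(q+γ) exp(-λ^(1+γ) τ) by τ^(-a), so the weighted norm N(t) of the difference
satisfies a Volterra inequality with integrable kernel (`norm_weightedDiff_le`): N(t) ≤ c t^(-a)
‖u₁(0) - u₂(0)‖ + ∫ (t-s)^(-a) ‖F(u₂) - F(u₁)‖ ds.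

Boundedness of F makes N(t) t^(a) finite a priori. Lipschitz continuity then improves any bound N ≤
B t^(-a) e^(ρt) to the constant m + B/2, once ρ is large, where m = c ‖u₁(0) - u₂(0)‖. Iterating
leaves 2m: the a priori constant, which is not proportional to the initial difference, disappears.
All norms are taken over finite index sets, uniformly, so convergence enters only at the end. -/

/-! ### Scalar weak equations. -/

open Filter Topology in
/-- The du Bois-Reymond lemma: a continuous function whose distributional derivative vanishes is
constant. -/
theorem Continuous.eq_of_integral_mul_deriv_eq_zero {D : ℝ → ℝ} (hD : Continuous D) {T : ℝ}
    (h : ∀ χ : ℝ → ℝ, ContDiff ℝ ∞ χ → HasCompactSupport χ → tsupport χ ⊆ Ioo 0 T →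
      ∫ t in Ioo 0 T, D t * deriv χ t = 0) {t : ℝ} (ht : t ∈ Icc 0 T) : D t = D 0 := by
  have key : ∀ s ∈ Ioo 0 T, ∀ t ∈ Ioo 0 T, D s = D t := by
    intro s hs t ht
    -- Mollify: the derivative of the mollified `D` at x is `D` tested against a translated bump
    -- derivative, hence zero while the bump stays inside (0, T).
    let φ : ℕ → ContDiffBump (0 : ℝ) := fun n =>
      ⟨1 / (n + 2), 1 / (n + 1), by positivity, by
        apply one_div_lt_one_div_of_lt <;> [positivity; linarith]⟩
    have hφ : Tendsto (fun n => (φ n).rOut) atTop (𝓝 0) := tendsto_one_div_add_atTop_nhds_zero_nat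
    have hlim := fun x => ContDiffBump.convolution_tendsto_right_of_continuous (μ := volume) hφ hD x
    refine tendsto_nhds_unique_of_eventuallyEq (hlim s) (hlim t) ?_
    have hpos : 0 < min (min s t) (min (T - s) (T - t)) := by
      simp only [lt_min_iff, sub_pos]; exact ⟨⟨hs.1, ht.1⟩, hs.2, ht.2⟩
    filter_upwards [hφ.eventually_lt_const hpos] with n hn
    simp only [lt_min_iff] at hn
    set ε := (φ n).rOut
    have hη : ContDiff ℝ ∞ ((φ n).normed volume) := (φ n).contDiff_normed
    have hηc : HasCompactSupport ((φ n).normed volume) := (φ n).hasCompactSupport_normed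
    have hder : ∀ x, HasDerivAt _ _ x := fun x =>
      hηc.hasDerivAt_convolution_left (ContinuousLinearMap.lsmul ℝ ℝ)
        (hη.of_le (by exact_mod_cast le_top)) hD.locallyIntegrable x (μ := volume)
    refine isOpen_Ioo.is_const_of_deriv_eq_zero (s := Ioo ε (T - ε)) isPreconnected_Ioo
      (fun x _ => (hder x).differentiableAt.differentiableWithinAt) ?_
      ⟨by linarith, by linarith⟩ ⟨by linarith, by linarith⟩
    intro x hx
    rw [Pi.zero_apply, (hder x).deriv, convolution_lsmul_swap]
    have hsupp : tsupport (fun r => (φ n).normed volume (x - r)) ⊆ Icc (x - ε) (x + ε) := by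
      refine closure_minimal ?_ isClosed_Icc
      intro r hr
      have h1 : x - r ∈ Function.support ((φ n).normed volume) := hr
      rw [(φ n).support_normed_eq, mem_ball_zero_iff, Real.norm_eq_abs, abs_lt] at h1
      constructor <;> linarith [h1.1, h1.2]
    have hsub : Icc (x - ε) (x + ε) ⊆ Ioo 0 T := fun r hr =>
      ⟨by linarith [hr.1, hx.1], by linarith [hr.2, hx.2]⟩
    have hd : ∀ r, deriv (fun r => (φ n).normed volume (x - r)) r
        = -deriv ((φ n).normed volume) (x - r) := fun r => deriv_comp_const_sub _ _ _
    have h0 := h (fun r => (φ n).normed volume (x - r)) (hη.comp (contDiff_const.sub contDiff_id))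
      (isCompact_Icc.of_isClosed_subset (isClosed_tsupport _) hsupp) (hsupp.trans hsub)
    rw [setIntegral_eq_integral_of_forall_compl_eq_zero] at h0
    · simp only [hd, mul_neg, integral_neg, neg_eq_zero] at h0
      exact (integral_congr_ae (ae_of_all _ fun r => mul_comm _ _)).trans h0
    · intro r hr
      have : r ∉ tsupport (fun r => (φ n).normed volume (x - r)) := fun h' => hr (hsub (hsupp h'))
      have h2 := fun h' => this (support_deriv_subset h')
      rw [Function.notMem_support.1 h2, mul_zero]
  rcases ht.1.eq_or_lt with h0 | h0
  · rw [← h0]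
  have hT : 0 < T := h0.trans_le ht.2
  have hEq : EqOn D (fun _ => D (T / 2)) (closure (Ioo 0 T)) :=
    EqOn.closure (fun s hs => key s hs _ ⟨by linarith, by linarith⟩) hD continuous_const
  rw [closure_Ioo hT.ne] at hEq
  rw [hEq ht, hEq ⟨le_rfl, hT.le⟩]

/-- The variation of constants formula for continuous distributional solutions of
`x' + μ x = h`. -/
theorem eq_exp_mul_add_integral_of_weak {T μ : ℝ} {x h : ℝ → ℝ}
    (hx : ContinuousOn x (Icc 0 T)) (hh : IntegrableOn h (Ioo 0 T))
    (hw : ∀ χ : ℝ → ℝ, ContDiff ℝ ∞ χ → HasCompactSupport χ → tsupport χ ⊆ Ioo 0 T →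
      -(∫ t in Ioo 0 T, x t * deriv χ t) + μ * ∫ t in Ioo 0 T, x t * χ t
        = ∫ t in Ioo 0 T, h t * χ t)
    {t : ℝ} (ht : t ∈ Icc 0 T) :
    x t = Real.exp (-μ * t) * x 0 + ∫ s in (0)..t, Real.exp (-μ * (t - s)) * h s := by
  have hT : 0 ≤ T := ht.1.trans ht.2
  have hexp : Continuous fun r => Real.exp (μ * r) := by fun_prop
  have hexps : ContDiff ℝ ∞ fun r => Real.exp (μ * r) := by fun_prop
  -- Integrating factor: `X` and the primitive `Y` of `G` have the same weak derivative, so `X - Y`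
  -- is constant. It is extended from [0, T] because the du Bois-Reymond lemma asks for continuity
  -- on the line.
  let X : ℝ → ℝ := fun r => Real.exp (μ * r) * x r
  let G : ℝ → ℝ := fun r => Real.exp (μ * r) * h r
  have hX : ContinuousOn X (Icc 0 T) := hexp.continuousOn.mul hx
  have hh' : IntervalIntegrable h volume 0 T := by
    rwa [intervalIntegrable_iff_integrableOn_Ioo_of_le hT]
  have hG : IntervalIntegrable G volume 0 T := hh'.continuousOn_mul hexp.continuousOn
  let Y : ℝ → ℝ := fun r => ∫ s in (0)..r, G s
  have hY : AbsolutelyContinuousOnInterval Y 0 T :=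
    hG.absolutelyContinuousOnInterval_intervalIntegral left_mem_uIcc
  have hYc : ContinuousOn Y (Icc 0 T) := by simpa [uIcc_of_le hT] using hY.continuousOn
  let D : ℝ → ℝ := IccExtend hT (domRestrict (Icc 0 T) fun r => X r - Y r)
  have hDc : Continuous D := (continuousOn_iff_continuous_domRestrict.1 (hX.sub hYc)).Icc_extend'
  have hDeq : ∀ r ∈ Icc 0 T, D r = X r - Y r := fun r hr => by
    simp only [D, IccExtend_of_mem hT _ hr]; rfl
  have hIoo : ∀ f : ℝ → ℝ, ContinuousOn f (Icc 0 T) → IntegrableOn f (Ioo 0 T) := fun f hf =>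
    (hf.integrableOn_Icc).mono_set Ioo_subset_Icc_self
  have hD0 : D t = D 0 := by
    refine hDc.eq_of_integral_mul_deriv_eq_zero ?_ ht
    intro χ hχ hχc hχs
    have hχ' : Continuous (deriv χ) := hχ.continuous_deriv (by simp)
    have h1 : ∫ r in Ioo 0 T, D r * deriv χ r
        = (∫ r in Ioo 0 T, X r * deriv χ r) - ∫ r in Ioo 0 T, Y r * deriv χ r := by
      refine .trans ?_ (integral_sub (hIoo _ (hX.mul hχ'.continuousOn))
        (hIoo _ (hYc.mul hχ'.continuousOn)))
      refine setIntegral_congr_fun measurableSet_Ioo fun r hr => ?_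
      simp only [hDeq r (Ioo_subset_Icc_self hr), sub_mul]
    have h2 : ∫ r in Ioo 0 T, X r * deriv χ r = - ∫ r in Ioo 0 T, G r * χ r := by
      have hsupp : tsupport (fun r => Real.exp (μ * r) * χ r) ⊆ tsupport χ :=
        tsupport_mul_subset_right
      -- Differentiating the exponential in this test function produces the term that cancels `μ * ∫
      -- x χ`.
      have h3 := hw (fun r => Real.exp (μ * r) * χ r) (hexps.mul hχ) hχc.mul_left
        (hsupp.trans hχs)
      have hd : ∀ r, deriv (fun r => Real.exp (μ * r) * χ r) r
          = Real.exp (μ * r) * μ * χ r + Real.exp (μ * r) * deriv χ r := by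
        intro r
        have e1 : HasDerivAt (fun r => Real.exp (μ * r)) (Real.exp (μ * r) * μ) r := by
          simpa using ((hasDerivAt_id r).const_mul μ).exp
        exact (e1.mul (hχ.differentiable (by simp) r).hasDerivAt).deriv
      have h4 : ∫ r in Ioo 0 T, x r * deriv (fun r => Real.exp (μ * r) * χ r) r
          = μ * (∫ r in Ioo 0 T, x r * (Real.exp (μ * r) * χ r))
            + ∫ r in Ioo 0 T, X r * deriv χ r := by
        rw [← integral_const_mul, ← integral_add]
        · refine integral_congr_ae (ae_of_all _ fun r => ?_)
          simp only [hd, X]; ring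
        · exact hIoo _ (continuousOn_const.mul (hx.mul (hexp.mul hχ.continuous).continuousOn))
        · exact hIoo _ (hX.mul hχ'.continuousOn)
      have h5 : ∫ r in Ioo 0 T, h r * (Real.exp (μ * r) * χ r) = ∫ r in Ioo 0 T, G r * χ r :=
        integral_congr_ae (ae_of_all _ fun r => by simp only [G]; ring)
      linarith
    have h6 : ∫ r in Ioo 0 T, Y r * deriv χ r = - ∫ r in Ioo 0 T, G r * χ r := by
      -- `h` is merely integrable, so `Y` is only absolutely continuous and integration by parts is
      -- needed in that class.
      have hχac : AbsolutelyContinuousOnInterval χ 0 T :=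
        (hχ.of_le (by exact_mod_cast le_top)).contDiffOn.absolutelyContinuousOnInterval
      have h7 := hY.integral_mul_deriv_eq_deriv_mul hχac
      have hχ0 : χ 0 = 0 := image_eq_zero_of_notMem_tsupport fun h' => lt_irrefl _ (hχs h').1
      have hχT : χ T = 0 := image_eq_zero_of_notMem_tsupport fun h' => lt_irrefl _ (hχs h').2
      have h8 : ∫ r in (0)..T, deriv Y r * χ r = ∫ r in (0)..T, G r * χ r := by
        refine intervalIntegral.integral_congr_ae ?_
        filter_upwards [hG.ae_hasDerivAt_integral] with r hr hr'
        rw [(hr (uIoc_subset_uIcc hr') 0 left_mem_uIcc).deriv]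
      rw [h8, hχ0, hχT] at h7
      rw [← integral_Ioc_eq_integral_Ioo, ← integral_Ioc_eq_integral_Ioo,
        ← intervalIntegral.integral_of_le hT, ← intervalIntegral.integral_of_le hT, h7]
      ring
    rw [h1, h2, h6, sub_self]
  rw [hDeq t ht, hDeq 0 ⟨le_rfl, hT⟩] at hD0
  have hY0 : Y 0 = 0 := intervalIntegral.integral_same
  have hX0 : X 0 = x 0 := by simp [X]
  have hXt : X t = x 0 + Y t := by linarith
  have hxt : x t = Real.exp (-μ * t) * X t := by
    simp only [X, ← mul_assoc, ← Real.exp_add]; simp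
  rw [hxt, hXt, mul_add, ← intervalIntegral.integral_const_mul]
  congr 1
  refine intervalIntegral.integral_congr fun s _ => ?_
  simp only [G, ← mul_assoc, ← Real.exp_add]
  congr 2; ring

/-! ### Kernel inequalities. -/

theorem Real.rpow_mul_exp_neg_le {x a τ : ℝ} (hx : 0 ≤ x) (ha : 0 ≤ a) (ha1 : a ≤ 1) (hτ : 0 < τ) :
    x ^ a * Real.exp (-x * τ) ≤ τ ^ (-a) := by
  have hy : 0 ≤ x * τ := by positivity
  have h1 : (x * τ) ^ a ≤ Real.exp (x * τ) := by
    have h2 := rpow_one_add_le_one_add_mul_self (s := x * τ - 1) (by linarith) ha ha1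
    have h3 := Real.add_one_le_exp (x * τ)
    rw [add_sub_cancel] at h2
    nlinarith
  rw [Real.mul_rpow hx hτ.le] at h1
  rw [neg_mul, Real.exp_neg, Real.rpow_neg hτ.le, ← div_eq_mul_inv,
    div_le_iff₀ (Real.exp_pos _), inv_mul_eq_div, le_div_iff₀ (by positivity)]
  exact h1

/-- This supplies the contraction. Subadditivity of the power splits the product of two
singularities into a sum. The exponential is traded for a small factor ρ^(-ε) at the price τ^(-ε);
with ε = (1-a)/2 the total exponent a + ε = (1+a)/2 stays below 1, hence integrable. -/
theorem add_rpow_mul_rpow_mul_exp_le {a s τ ρ : ℝ} (ha : 0 < a) (ha1 : a < 1) (hs : 0 < s)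
    (hτ : 0 < τ) (hρ : 0 < ρ) :
    (s + τ) ^ a * τ ^ (-a) * s ^ (-a) * Real.exp (-ρ * τ)
      ≤ ρ ^ (-((1 - a) / 2)) * (s ^ (-((1 + a) / 2)) + 2 * τ ^ (-((1 + a) / 2))) := by
  set ε := (1 - a) / 2 with hε
  have hb : -((1 + a) / 2) = -a + -ε := by rw [hε]; ring
  have hε0 : 0 < ε := by rw [hε]; linarith
  have h1 : Real.exp (-ρ * τ) ≤ ρ ^ (-ε) * τ ^ (-ε) := by
    have h2 := Real.rpow_mul_exp_neg_le hρ.le hε0.le (by linarith) hτ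
    rw [Real.rpow_neg hρ.le, inv_mul_eq_div, le_div_iff₀ (by positivity), mul_comm]
    exact h2
  have h2 : (s + τ) ^ a ≤ s ^ a + τ ^ a := Real.rpow_add_le_add_rpow hs.le hτ.le ha.le ha1.le
  have h3 : (s + τ) ^ a * τ ^ (-a) * s ^ (-a) ≤ τ ^ (-a) + s ^ (-a) := by
    calc (s + τ) ^ a * τ ^ (-a) * s ^ (-a) ≤ (s ^ a + τ ^ a) * τ ^ (-a) * s ^ (-a) := by gcongr
      _ = τ ^ (-a) + s ^ (-a) := by
        rw [Real.rpow_neg hs.le, Real.rpow_neg hτ.le]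
        have := (Real.rpow_pos_of_pos hs a).ne'
        have := (Real.rpow_pos_of_pos hτ a).ne'
        field_simp
  have h4 : s ^ (-a) * τ ^ (-ε) ≤ s ^ (-a + -ε) + τ ^ (-a + -ε) := by
    -- The mixed product is at most the pure power of the smaller of `s` and `τ`.
    rw [Real.rpow_add hs, Real.rpow_add hτ]
    rcases le_total s τ with h | h
    · have : τ ^ (-ε) ≤ s ^ (-ε) := Real.rpow_le_rpow_of_nonpos hs h (by linarith)
      have : s ^ (-a) * τ ^ (-ε) ≤ s ^ (-a) * s ^ (-ε) := by gcongr
      have : 0 ≤ τ ^ (-a) * τ ^ (-ε) := by positivity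
      linarith
    · have : s ^ (-a) ≤ τ ^ (-a) := Real.rpow_le_rpow_of_nonpos hτ h (by linarith)
      have : s ^ (-a) * τ ^ (-ε) ≤ τ ^ (-a) * τ ^ (-ε) := by gcongr
      have : 0 ≤ s ^ (-a) * s ^ (-ε) := by positivity
      linarith
  calc (s + τ) ^ a * τ ^ (-a) * s ^ (-a) * Real.exp (-ρ * τ)
      ≤ (τ ^ (-a) + s ^ (-a)) * (ρ ^ (-ε) * τ ^ (-ε)) := by gcongr
    _ = ρ ^ (-ε) * (τ ^ (-a) * τ ^ (-ε) + s ^ (-a) * τ ^ (-ε)) := by ring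
    _ ≤ ρ ^ (-ε) * (s ^ (-((1 + a) / 2)) + 2 * τ ^ (-((1 + a) / 2))) := by
      rw [← Real.rpow_add hτ, hb]
      exact mul_le_mul_of_nonneg_left (by linarith) (by positivity)

theorem integrableOn_rpow_neg {b : ℝ} (hb : b < 1) (t : ℝ) :
    IntegrableOn (fun s : ℝ => s ^ (-b)) (Ioo 0 t) := by
  rcases le_or_gt t 0 with ht | ht
  · simp [Ioo_eq_empty_of_le ht]
  · rw [← intervalIntegrable_iff_integrableOn_Ioo_of_le ht.le]
    exact intervalIntegral.intervalIntegrable_rpow' (by linarith)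

theorem integral_rpow_neg {b : ℝ} (hb : b < 1) {t : ℝ} (ht : 0 ≤ t) :
    ∫ s in Ioo 0 t, s ^ (-b) = t ^ (1 - b) / (1 - b) := by
  rw [← integral_Ioc_eq_integral_Ioo, ← intervalIntegral.integral_of_le ht,
    integral_rpow (Or.inl (by linarith)), Real.zero_rpow (by linarith), sub_zero]
  rw [show -b + 1 = 1 - b by ring]

theorem integrableOn_sub_rpow_neg {b : ℝ} (hb : b < 1) {t : ℝ} (ht : 0 ≤ t) :
    IntegrableOn (fun s : ℝ => (t - s) ^ (-b)) (Ioo 0 t) := by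
  rw [← intervalIntegrable_iff_integrableOn_Ioo_of_le ht]
  have h : IntervalIntegrable (fun s : ℝ => s ^ (-b)) volume 0 t :=
    intervalIntegral.intervalIntegrable_rpow' (by linarith)
  simpa using (h.comp_sub_left t).symm

theorem integral_sub_rpow_neg {b : ℝ} (hb : b < 1) {t : ℝ} (ht : 0 ≤ t) :
    ∫ s in Ioo 0 t, (t - s) ^ (-b) = t ^ (1 - b) / (1 - b) := by
  rw [← integral_rpow_neg hb ht, ← integral_Ioc_eq_integral_Ioo, ← integral_Ioc_eq_integral_Ioo,
    ← intervalIntegral.integral_of_le ht, ← intervalIntegral.integral_of_le ht,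
    intervalIntegral.integral_comp_sub_left (fun s => s ^ (-b)) t, sub_self, sub_zero]

/-! ### Fourier coefficients and the scale H^s. -/

namespace HilbertBasis

variable {ι H : Type*} [NormedAddCommGroup H] [InnerProductSpace ℝ H] (e : HilbertBasis ι ℝ H)

theorem norm_sum_smul_sq (S : Finset ι) (a : ι → ℝ) :
    ‖∑ n ∈ S, a n • e n‖ ^ 2 = ∑ n ∈ S, a n ^ 2 := by
  rw [← real_inner_self_eq_norm_sq, e.orthonormal.inner_sum]
  simp [sq]

/-- The operators involved are diagonal in the basis, so each norm estimate reduces through this to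
a bound on the multiplier. -/
theorem norm_sum_smul_le {S : Finset ι} {a b : ι → ℝ} {K R : ℝ} (hK : 0 ≤ K) (hR : 0 ≤ R)
    (h : ∀ n ∈ S, |a n| ≤ K * |b n|) (hb : ∑ n ∈ S, b n ^ 2 ≤ R ^ 2) :
    ‖∑ n ∈ S, a n • e n‖ ≤ K * R := by
  refine le_of_sq_le_sq ?_ (by positivity)
  rw [norm_sum_smul_sq, mul_pow]
  calc ∑ n ∈ S, a n ^ 2 ≤ ∑ n ∈ S, K ^ 2 * b n ^ 2 := Finset.sum_le_sum fun n hn => by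
        rw [← sq_abs (a n), ← sq_abs (b n), ← mul_pow]
        exact pow_le_pow_left₀ (abs_nonneg _) (h n hn) 2
    _ ≤ K ^ 2 * R ^ 2 := by rw [← Finset.mul_sum]; gcongr

theorem sum_inner_sq_le (S : Finset ι) (x : H) : ∑ n ∈ S, inner ℝ (e n) x ^ 2 ≤ ‖x‖ ^ 2 := by
  simpa using e.orthonormal.sum_inner_products_le x (s := S)

end HilbertBasis

namespace EigenBasis

variable {H : Type*} [NormedAddCommGroup H] [InnerProductSpace ℝ H] [CompleteSpace H]
  {A : PosOperator H} (E : EigenBasis A)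

theorem sum_sq_le {s : ℝ} (u : E.Hs s) (S : Finset ℕ) :
    ∑ n ∈ S, (E.lam n ^ (s / 2) * E.coeff u n) ^ 2 ≤ ‖u‖ ^ 2 := by
  have h := lp.sum_rpow_le_norm_rpow (p := 2) (by norm_num) (E.toL2 s u) S
  norm_num at h
  exact h

theorem abs_coeff_le {s : ℝ} (u : E.Hs s) (n : ℕ) :
    |E.coeff u n| ≤ E.lam n ^ (-(s / 2)) * ‖u‖ := by
  have hl := E.lam_pos n
  have h := E.sum_sq_le u {n}
  rw [Finset.sum_singleton] at h
  have h1 := abs_le_of_sq_le_sq h (norm_nonneg _)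
  rw [abs_mul, abs_of_pos (Real.rpow_pos_of_pos hl _)] at h1
  rw [Real.rpow_neg hl.le, inv_mul_eq_div, le_div_iff₀ (Real.rpow_pos_of_pos hl _), mul_comm]
  exact h1

theorem continuous_coeff (s : ℝ) (n : ℕ) : Continuous fun u : E.Hs s => E.coeff u n :=
  (LinearMap.mkContinuous (σ := RingHom.id ℝ)
    { toFun := fun u : E.Hs s => E.coeff u n
      map_add' := fun _ _ => rfl
      map_smul' := fun _ _ => rfl } _ (E.abs_coeff_le · n)).continuous

/-- Passes from bounds uniform over finite index sets to membership in H^s. -/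
theorem exists_of_sum_sq_le {s R : ℝ} (hR : 0 ≤ R) {a : ℕ → ℝ}
    (h : ∀ S : Finset ℕ, ∑ n ∈ S, (E.lam n ^ (s / 2) * a n) ^ 2 ≤ R ^ 2) :
    ∃ d : E.Hs s, E.coeff d = a ∧ ‖d‖ ≤ R := by
  have hmem : Memℓp (E.pow (s / 2) a) 2 := by
    refine memℓp_gen' (C := R ^ 2) fun S => ?_
    simpa [pow, ← mul_pow, ← abs_mul] using h S
  refine ⟨⟨a, hmem⟩, rfl, ?_⟩
  refine lp.norm_le_of_forall_sum_le (p := 2) (by norm_num) hR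
    (f := E.toL2 s (⟨a, hmem⟩ : E.HsSubmodule s)) fun S => ?_
  have h1 := h S
  norm_num
  exact h1

/-- The `n`-th eigenvector as an element of `H ^ s`. -/
theorem exists_coeff_eq_single (s : ℝ) (n : ℕ) : ∃ d : E.Hs s, E.coeff d = Pi.single n 1 := by
  obtain ⟨d, hd, -⟩ := E.exists_of_sum_sq_le (s := s) (R := E.lam n ^ (s / 2))
    (Real.rpow_nonneg (E.lam_pos n).le _) (a := Pi.single n 1) fun S => by
      calc ∑ m ∈ S, (E.lam m ^ (s / 2) * (Pi.single n 1 : ℕ → ℝ) m) ^ 2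
          ≤ ∑ m ∈ S, if n = m then (E.lam n ^ (s / 2)) ^ 2 else 0 := by
            refine Finset.sum_le_sum fun m _ => ?_
            rcases eq_or_ne n m with rfl | h
            · simp
            · simp [h]
        _ ≤ _ := by
            rw [Finset.sum_ite_eq]
            split_ifs
            · exact le_rfl
            · positivity
  exact ⟨d, hd⟩

theorem memℓp_coeff (u : E.Hs 1) : Memℓp (E.coeff u) 2 := by
  refine memℓp_gen' (C := (E.lam 0 ^ (-(1 / 2 : ℝ)) * ‖u‖) ^ 2) fun S => ?_
  have hl := E.lam_pos 0
  have h : ∀ n, |E.coeff u n| ≤ E.lam 0 ^ (-(1 / 2 : ℝ)) *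
      |E.lam n ^ (1 / 2 : ℝ) * E.coeff u n| := fun n => by
    have h1 : E.lam 0 ^ (1 / 2 : ℝ) ≤ E.lam n ^ (1 / 2 : ℝ) :=
      Real.rpow_le_rpow hl.le (E.mono (Nat.zero_le n)) (by norm_num)
    rw [Real.rpow_neg hl.le, inv_mul_eq_div, le_div_iff₀ (Real.rpow_pos_of_pos hl _), abs_mul,
      abs_of_pos (Real.rpow_pos_of_pos (E.lam_pos n) _), mul_comm]
    gcongr
  have h2 := E.e.norm_sum_smul_le (by positivity) (norm_nonneg u) (fun n (_ : n ∈ S) => h n)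
    (E.sum_sq_le u S)
  have h3 := pow_le_pow_left₀ (norm_nonneg _) h2 2
  rw [E.e.norm_sum_smul_sq] at h3
  simpa using h3

theorem hasSum_toH {a : ℕ → ℝ} (ha : Memℓp a 2) : HasSum (fun n => a n • E.e n) (E.toH a) :=
  (E.e.hasSum_repr_symm ⟨a, ha⟩).summable.hasSum

theorem norm_toH_sub_le {a b : ℕ → ℝ} (ha : Memℓp a 2) (hb : Memℓp b 2) {R : ℝ}
    (h : ∀ S : Finset ℕ, ‖∑ n ∈ S, (a n - b n) • E.e n‖ ≤ R) : ‖E.toH a - E.toH b‖ ≤ R := by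
  have h1 := (E.hasSum_toH ha).sub (E.hasSum_toH hb)
  refine le_of_tendsto h1.norm (Filter.Eventually.of_forall fun S => ?_)
  simpa only [sub_smul] using h S

theorem toH_smul_single (n : ℕ) (c : ℝ) : E.toH (c • Pi.single n 1) = c • E.e n := by
  rw [toH, tsum_eq_single n]
  · simp
  · intro m hm; simp [hm]

theorem pairing_pow_smul_single (a : ℕ → ℝ) (s : ℝ) (n : ℕ) (c : ℝ) :
    pairing a (E.pow s (c • Pi.single n 1)) = E.lam n ^ s * (a n * c) := by
  rw [pairing, tsum_eq_single n]
  · simp [pow]; ring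
  · intro m hm; simp [pow, hm]

/-! ### Solutions in Fourier coefficients. -/

namespace IsSolution

variable {E} {γ : ℝ} {F : H → H} {g : H} {T : ℝ} {u : ℝ → E.Hs (-γ)}

theorem continuousOn_coeff (hu : E.IsSolution γ F g T u) (n : ℕ) :
    ContinuousOn (fun t => E.coeff (u t) n) (Icc 0 T) :=
  (E.continuous_coeff _ n).comp_continuousOn hu.continuousOn

/-- `toH` is a `tsum`, with default value 0 when the series diverges. Since u(t) lies a priori only
in H^(-γ), it represents u(t) only for those t where the H^1 information is available. -/
theorem ae_memℓp (hu : E.IsSolution γ F g T u) :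
    ∀ᵐ t ∂(volume.restrict (Ioo 0 T)), Memℓp (E.coeff (u t)) 2 := by
  obtain ⟨w, -, hw⟩ := hu.memL2
  filter_upwards [hw] with t ht
  rw [← ht]
  exact E.memℓp_coeff _

/-- Continuity in H^(-γ) gives none in H, but the partial Fourier sums are continuous in time and
converge almost everywhere. -/
theorem aestronglyMeasurable_toH (hu : E.IsSolution γ F g T u) :
    AEStronglyMeasurable (fun t => E.toH (E.coeff (u t))) (volume.restrict (Ioo 0 T)) := by
  refine aestronglyMeasurable_of_tendsto_ae Filter.atTop
    (f := fun N t => ∑ n ∈ Finset.range N, E.coeff (u t) n • E.e n) (fun N => ?_) ?_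
  · refine ContinuousOn.aestronglyMeasurable ?_ measurableSet_Ioo
    exact continuousOn_finsetSum _ fun n _ =>
      ((hu.continuousOn_coeff n).mono Ioo_subset_Icc_self).smul continuousOn_const
  · filter_upwards [hu.ae_memℓp] with t ht
    exact (E.hasSum_toH ht).tendsto_sum_nat

theorem integrableOn_comp (hu : E.IsSolution γ F g T u) (hF : Continuous F) {M : ℝ}
    (hM : ∀ x, ‖F x‖ ≤ M) : IntegrableOn (fun t => F (E.toH (E.coeff (u t)))) (Ioo 0 T) :=
  Integrable.of_bound (hF.comp_aestronglyMeasurable hu.aestronglyMeasurable_toH) M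
    (ae_of_all _ fun _ => hM _)

/-- Variation of constants for the Fourier coefficients of a solution. -/
theorem coeff_eq (hu : E.IsSolution γ F g T u) (hF : Continuous F) {M : ℝ}
    (hM : ∀ x, ‖F x‖ ≤ M) (n : ℕ) {t : ℝ} (ht : t ∈ Icc 0 T) :
    E.coeff (u t) n = Real.exp (-E.lam n ^ (1 + γ) * t) * E.coeff (u 0) n
      + ∫ s in (0)..t, Real.exp (-E.lam n ^ (1 + γ) * (t - s)) *
        (E.lam n ^ γ * inner ℝ (E.e n) (g - F (E.toH (E.coeff (u s))))) := by
  have hl := E.lam_pos n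
  have hint : IntegrableOn (fun s => g - F (E.toH (E.coeff (u s)))) (Ioo 0 T) :=
    (integrableOn_const (by simp)).sub (hu.integrableOn_comp hF hM)
  refine eq_exp_mul_add_integral_of_weak (x := fun t => E.coeff (u t) n)
    (hu.continuousOn_coeff n) ((hint.const_inner (E.e n)).const_mul _) ?_ ht
  intro χ hχ hχc hχs
  obtain ⟨d, hd⟩ := E.exists_coeff_eq_single 2 n
  have hφs : tsupport (fun t => χ t • d) ⊆ tsupport χ :=
    closure_mono fun t ht h0 => ht (by simp only [h0, zero_smul])
  have h := hu.weak (fun t => χ t • d) (hχ.smul contDiff_const)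
    (hχc.smul_right) (hφs.trans hχs)
  have hder : ∀ t, deriv (fun t => χ t • d) t = deriv χ t • d := fun t =>
    ((hχ.differentiable (by simp) t).hasDerivAt.smul_const d).deriv
  have hc : ∀ c : ℝ, E.coeff (c • d) = c • Pi.single n 1 := fun c => by rw [← hd]; rfl
  simp only [hder, hc, E.pairing_pow_smul_single, E.toH_smul_single, real_inner_smul_right,
    integral_const_mul, Real.rpow_one] at h
  have h1 : ∫ t in Ioo 0 T, E.lam n ^ γ * inner ℝ (E.e n) (g - F (E.toH (E.coeff (u t)))) * χ t
      = E.lam n ^ γ *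
        ∫ t in Ioo 0 T, χ t * inner ℝ (g - F (E.toH (E.coeff (u t)))) (E.e n) := by
    rw [← integral_const_mul]
    refine integral_congr_ae (ae_of_all _ fun t => ?_)
    simp only [real_inner_comm (E.e n)]; ring
  -- Multiplying the tested equation by λ^γ normalises the time derivative and turns the rate λ into
  -- λ^(1+γ).
  have h2 : E.lam n ^ γ * E.lam n ^ (-γ) = 1 := by rw [← Real.rpow_add hl]; simp
  rw [h1, ← h, Real.rpow_add hl, Real.rpow_one, mul_add, mul_neg, ← mul_assoc, h2]
  ring

end IsSolution

end EigenBasis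

/-! ### Smoothing estimates for the difference. -/

theorem integrableOn_exp_mul_inner {H : Type*} [NormedAddCommGroup H] [InnerProductSpace ℝ H]
    {f : ℝ → H} {t : ℝ} (hf : IntegrableOn f (Ioo 0 t)) (ht : 0 ≤ t) (μ c : ℝ) (e : H) :
    IntegrableOn (fun s => Real.exp (-μ * (t - s)) * (c * inner ℝ e (f s))) (Ioo 0 t) := by
  have h : IntegrableOn (fun s => c * inner ℝ e (f s)) (Ioo 0 t) := (hf.const_inner e).const_mul c
  rw [← intervalIntegrable_iff_integrableOn_Ioo_of_le ht] at h ⊢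
  exact h.continuousOn_mul (by fun_prop)

namespace EigenBasis

variable {H : Type*} [NormedAddCommGroup H] [InnerProductSpace ℝ H] [CompleteSpace H]
  {A : PosOperator H} (E : EigenBasis A)

/-- The part of the difference of two Fourier series with indices in `S`, weighted by
`lam n ^ q`. -/
noncomputable def weightedDiff (q : ℝ) (a b : ℕ → ℝ) (S : Finset ℕ) : H :=
  ∑ n ∈ S, (E.lam n ^ q * (a n - b n)) • E.e n

theorem norm_sum_sub_le {q : ℝ} (hq : 0 ≤ q) (a b : ℕ → ℝ) (S : Finset ℕ) :
    ‖∑ n ∈ S, (a n - b n) • E.e n‖ ≤ E.lam 0 ^ (-q) * ‖E.weightedDiff q a b S‖ := by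
  have hl := E.lam_pos 0
  refine E.e.norm_sum_smul_le (b := fun n => E.lam n ^ q * (a n - b n)) (by positivity)
    (norm_nonneg _) (fun n _ => ?_) (E.e.norm_sum_smul_sq S _).ge
  rw [abs_mul, abs_of_pos (Real.rpow_pos_of_pos (E.lam_pos n) _), ← mul_assoc]
  refine le_mul_of_one_le_left (abs_nonneg _) ?_
  rw [Real.rpow_neg hl.le, inv_mul_eq_div, one_le_div (Real.rpow_pos_of_pos hl _)]
  exact Real.rpow_le_rpow hl.le (E.mono (Nat.zero_le n)) hq

/-- With x = λ^(1+γ), the balance `hq` says exactly that λ^(q+γ) = x^a. -/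
theorem rpow_mul_exp_mul_rpow_le {γ q a τ : ℝ} (ha : 0 ≤ a) (ha1 : a ≤ 1)
    (hq : q + γ = (1 + γ) * a) (hτ : 0 < τ) (n : ℕ) :
    E.lam n ^ q * (Real.exp (-E.lam n ^ (1 + γ) * τ) * E.lam n ^ γ) ≤ τ ^ (-a) := by
  have hl := E.lam_pos n
  have h := Real.rpow_mul_exp_neg_le (x := E.lam n ^ (1 + γ)) (by positivity) ha ha1 hτ
  rw [← Real.rpow_mul hl.le, ← hq, Real.rpow_add hl] at h
  linarith

/-- Write λ^q = λ^(q+γ) λ^(-γ/2) λ^(-γ/2): the first factor is smoothed by the exponential, the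
second is largest at the lowest eigenvalue, the third belongs to the H^(-γ) norm. -/
theorem norm_sum_exp_smul_le {γ q a t : ℝ} (hγ : 0 ≤ γ) (ha : 0 ≤ a) (ha1 : a ≤ 1)
    (hq : q + γ = (1 + γ) * a) (ht : 0 < t) (d : E.Hs (-γ)) (S : Finset ℕ) :
    ‖∑ n ∈ S, (E.lam n ^ q * (Real.exp (-E.lam n ^ (1 + γ) * t) * E.coeff d n)) • E.e n‖
      ≤ t ^ (-a) * E.lam 0 ^ (-(γ / 2)) * ‖d‖ := by
  have hl0 := E.lam_pos 0
  refine E.e.norm_sum_smul_le (by positivity) (norm_nonneg _) (fun n _ => ?_) (E.sum_sq_le d S)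
  have hl := E.lam_pos n
  have h := E.rpow_mul_exp_mul_rpow_le ha ha1 hq ht n
  have h1 : E.lam n ^ (-(γ / 2)) ≤ E.lam 0 ^ (-(γ / 2)) :=
    Real.rpow_le_rpow_of_nonpos hl0 (E.mono (Nat.zero_le n)) (by linarith)
  have h2 : E.lam n ^ γ * E.lam n ^ (-(γ / 2)) * E.lam n ^ (-γ / 2) = 1 := by
    rw [← Real.rpow_add hl, ← Real.rpow_add hl]
    simp only [show γ + -(γ / 2) + -γ / 2 = 0 by ring, Real.rpow_zero]
  have h3 : E.lam n ^ q * (Real.exp (-E.lam n ^ (1 + γ) * t) * E.coeff d n)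
      = (E.lam n ^ q * (Real.exp (-E.lam n ^ (1 + γ) * t) * E.lam n ^ γ)) * E.lam n ^ (-(γ / 2))
        * (E.lam n ^ (-γ / 2) * E.coeff d n) := by
    linear_combination
      -(E.lam n ^ q * (Real.exp (-E.lam n ^ (1 + γ) * t) * E.coeff d n)) * h2
  rw [h3, abs_mul]
  refine mul_le_mul_of_nonneg_right ?_ (abs_nonneg _)
  rw [abs_of_pos (by positivity)]
  gcongr

theorem norm_sum_exp_smul_inner_le {γ q a τ : ℝ} (ha : 0 ≤ a) (ha1 : a ≤ 1)
    (hq : q + γ = (1 + γ) * a) (hτ : 0 < τ) (f : H) (S : Finset ℕ) :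
    ‖∑ n ∈ S, (E.lam n ^ q * (Real.exp (-E.lam n ^ (1 + γ) * τ) *
      (E.lam n ^ γ * inner ℝ (E.e n) f))) • E.e n‖ ≤ τ ^ (-a) * ‖f‖ := by
  refine E.e.norm_sum_smul_le (by positivity) (norm_nonneg _) (fun n _ => ?_)
    (E.e.sum_inner_sq_le S f)
  have hl := E.lam_pos n
  rw [← mul_assoc (Real.exp _), ← mul_assoc (E.lam n ^ q), abs_mul, abs_of_pos (by positivity)]
  exact mul_le_mul_of_nonneg_right (E.rpow_mul_exp_mul_rpow_le ha ha1 hq hτ n) (abs_nonneg _)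

namespace IsSolution

variable {E} {γ : ℝ} {F : H → H} {g : H} {T : ℝ} {u₁ u₂ : ℝ → E.Hs (-γ)}

theorem coeff_sub_eq (hu₁ : E.IsSolution γ F g T u₁) (hu₂ : E.IsSolution γ F g T u₂)
    (hF : Continuous F) {M : ℝ} (hM : ∀ x, ‖F x‖ ≤ M) (n : ℕ) {t : ℝ} (ht : t ∈ Icc 0 T) :
    E.coeff (u₁ t) n - E.coeff (u₂ t) n
      = Real.exp (-E.lam n ^ (1 + γ) * t) * E.coeff (u₁ 0 - u₂ 0) n
      + ∫ s in Ioo 0 t, Real.exp (-E.lam n ^ (1 + γ) * (t - s)) * (E.lam n ^ γ *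
        inner ℝ (E.e n) (F (E.toH (E.coeff (u₂ s))) - F (E.toH (E.coeff (u₁ s))))) := by
  have hint : ∀ u : ℝ → E.Hs (-γ), E.IsSolution γ F g T u → IntegrableOn (fun s =>
      Real.exp (-E.lam n ^ (1 + γ) * (t - s)) * (E.lam n ^ γ *
        inner ℝ (E.e n) (g - F (E.toH (E.coeff (u s)))))) (Ioo 0 t) := fun u hu => by
    have h1 : IntegrableOn (fun s => g - F (E.toH (E.coeff (u s)))) (Ioo 0 T) :=
      (integrableOn_const (by simp)).sub (hu.integrableOn_comp hF hM)
    exact integrableOn_exp_mul_inner (h1.mono_set (Ioo_subset_Ioo_right ht.2)) ht.1 _ _ _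
  have hc : E.coeff (u₁ 0 - u₂ 0) n = E.coeff (u₁ 0) n - E.coeff (u₂ 0) n := rfl
  rw [hu₁.coeff_eq hF hM n ht, hu₂.coeff_eq hF hM n ht, hc,
    intervalIntegral.integral_of_le ht.1, intervalIntegral.integral_of_le ht.1,
    integral_Ioc_eq_integral_Ioo, integral_Ioc_eq_integral_Ioo, add_sub_add_comm, ← mul_sub,
    ← integral_sub (hint u₁ hu₁) (hint u₂ hu₂)]
  congr 1
  refine integral_congr_ae (ae_of_all _ fun s => ?_)
  simp only [inner_sub_right]; ring

/-- The smoothing estimate, in terms of a majorant of the nonlinear part. -/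
theorem norm_weightedDiff_le (hu₁ : E.IsSolution γ F g T u₁) (hu₂ : E.IsSolution γ F g T u₂)
    (hF : Continuous F) {M : ℝ} (hM : ∀ x, ‖F x‖ ≤ M) {q a t : ℝ} (hγ : 0 ≤ γ) (ha : 0 ≤ a)
    (ha1 : a ≤ 1) (hq : q + γ = (1 + γ) * a) (ht : 0 < t) (htT : t ≤ T) (S : Finset ℕ)
    {Φ : ℝ → ℝ} (hΦ : IntegrableOn Φ (Ioo 0 t))
    (hΦle : ∀ᵐ s ∂(volume.restrict (Ioo 0 t)), (t - s) ^ (-a) *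
      ‖F (E.toH (E.coeff (u₂ s))) - F (E.toH (E.coeff (u₁ s)))‖ ≤ Φ s) :
    ‖E.weightedDiff q (E.coeff (u₁ t)) (E.coeff (u₂ t)) S‖
      ≤ t ^ (-a) * E.lam 0 ^ (-(γ / 2)) * ‖u₁ 0 - u₂ 0‖ + ∫ s in Ioo 0 t, Φ s := by
  set f : ℝ → H := fun s => F (E.toH (E.coeff (u₂ s))) - F (E.toH (E.coeff (u₁ s))) with hf
  have hfint : IntegrableOn f (Ioo 0 t) :=
    ((hu₂.integrableOn_comp hF hM).sub (hu₁.integrableOn_comp hF hM)).mono_set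
      (Ioo_subset_Ioo_right htT)
  let k : ℕ → ℝ → ℝ := fun n s => E.lam n ^ q * (Real.exp (-E.lam n ^ (1 + γ) * (t - s)) *
    (E.lam n ^ γ * inner ℝ (E.e n) (f s)))
  have hk : ∀ n, IntegrableOn (k n) (Ioo 0 t) := fun n =>
    (integrableOn_exp_mul_inner hfint ht.le _ _ _).const_mul _
  have hsplit : E.weightedDiff q (E.coeff (u₁ t)) (E.coeff (u₂ t)) S
      = (∑ n ∈ S, (E.lam n ^ q * (Real.exp (-E.lam n ^ (1 + γ) * t) *
          E.coeff (u₁ 0 - u₂ 0) n)) • E.e n)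
        + ∫ s in Ioo 0 t, ∑ n ∈ S, k n s • E.e n := by
    rw [integral_finsetSum S fun n _ => (hk n).smul_const (E.e n), weightedDiff,
      ← Finset.sum_add_distrib]
    refine Finset.sum_congr rfl fun n _ => ?_
    rw [integral_smul_const, ← add_smul, coeff_sub_eq hu₁ hu₂ hF hM n ⟨ht.le, htT⟩, mul_add,
      ← integral_const_mul]
  rw [hsplit]
  refine (norm_add_le _ _).trans (add_le_add
    (E.norm_sum_exp_smul_le hγ ha ha1 hq ht _ S) (norm_integral_le_of_norm_le hΦ ?_))
  filter_upwards [hΦle, ae_restrict_mem measurableSet_Ioo] with s hs hst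
  exact (E.norm_sum_exp_smul_inner_le ha ha1 hq (sub_pos.2 hst.2) (f s) S).trans hs

end IsSolution

end EigenBasis

/-! ### Singular Gronwall argument. -/

/-- The map B ↦ m + B/2 contracts to its fixed point 2m, so the starting constant `B₀` need only be
finite; its size is forgotten. -/
theorem le_two_mul_of_forall_le_add_half {ι : Type*} {N φ : ι → ℝ} (hφ : ∀ i, 0 ≤ φ i)
    {m B₀ : ℝ} (hm : 0 ≤ m) (hB₀ : 0 ≤ B₀) (h₀ : ∀ i, N i ≤ B₀ * φ i)
    (hstep : ∀ B, 0 ≤ B → (∀ i, N i ≤ B * φ i) → ∀ i, N i ≤ (m + B / 2) * φ i) (i : ι) :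
    N i ≤ 2 * m * φ i := by
  have h : ∀ k : ℕ, ∀ i, N i ≤ (2 * m + B₀ * (1 / 2) ^ k) * φ i := by
    intro k
    induction k with
    | zero =>
      intro i
      refine (h₀ i).trans (mul_le_mul_of_nonneg_right ?_ (hφ i))
      rw [pow_zero]; linarith
    | succ k ih =>
      intro i
      refine (hstep _ (by positivity) ih i).trans_eq ?_
      rw [pow_succ]; ring
  have hlim : Filter.Tendsto (fun k : ℕ => (2 * m + B₀ * (1 / 2) ^ k) * φ i) Filter.atTop
      (nhds ((2 * m + B₀ * 0) * φ i)) :=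
    (((tendsto_pow_atTop_nhds_zero_of_lt_one (by norm_num) (by norm_num)).const_mul
      B₀).const_add _).mul_const _
  simpa using ge_of_tendsto' hlim fun k => h k i

namespace EigenBasis

variable {H : Type*} [NormedAddCommGroup H] [InnerProductSpace ℝ H] [CompleteSpace H]
  {A : PosOperator H} {E : EigenBasis A} {γ : ℝ} {F : H → H} {g : H} {T : ℝ}
  {u₁ u₂ : ℝ → E.Hs (-γ)}

namespace IsSolution

/-- The a priori bound, from the boundedness of the nonlinearity. -/
theorem norm_weightedDiff_le_of_bound (hu₁ : E.IsSolution γ F g T u₁)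
    (hu₂ : E.IsSolution γ F g T u₂) (hF : Continuous F) {M : ℝ} (hM : ∀ x, ‖F x‖ ≤ M) {q a t : ℝ}
    (hγ : 0 ≤ γ) (ha : 0 ≤ a) (ha1 : a < 1) (hq : q + γ = (1 + γ) * a) (ht : 0 < t) (ht1 : t ≤ 1)
    (htT : t ≤ T) (S : Finset ℕ) :
    ‖E.weightedDiff q (E.coeff (u₁ t)) (E.coeff (u₂ t)) S‖
      ≤ (E.lam 0 ^ (-(γ / 2)) * ‖u₁ 0 - u₂ 0‖ + 2 * M / (1 - a)) * t ^ (-a) := by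
  have hM0 : 0 ≤ M := (norm_nonneg _).trans (hM 0)
  have h := hu₁.norm_weightedDiff_le hu₂ hF hM hγ ha ha1.le hq ht htT S
    (Φ := fun s => 2 * M * (t - s) ^ (-a)) ((integrableOn_sub_rpow_neg ha1 ht.le).const_mul _) (by
      filter_upwards [ae_restrict_mem measurableSet_Ioo] with s hs
      have h1 : ‖F (E.toH (E.coeff (u₂ s))) - F (E.toH (E.coeff (u₁ s)))‖ ≤ 2 * M :=
        (norm_sub_le _ _).trans ((add_le_add (hM _) (hM _)).trans_eq (two_mul M).symm)
      rw [mul_comm]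
      exact mul_le_mul_of_nonneg_right h1 (Real.rpow_nonneg (sub_pos.2 hs.2).le _))
  rw [integral_const_mul, integral_sub_rpow_neg ha1 ht.le] at h
  have h1 : t ^ (1 - a) ≤ 1 := Real.rpow_le_one ht.le ht1 (by linarith)
  have h2 : 1 ≤ t ^ (-a) := Real.one_le_rpow_of_pos_of_le_one_of_nonpos ht ht1 (by linarith)
  have h3 : 0 < 1 - a := by linarith
  have h4 : 2 * M * (t ^ (1 - a) / (1 - a)) ≤ 2 * M / (1 - a) * t ^ (-a) := by
    rw [mul_div_assoc', div_mul_eq_mul_div]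
    exact div_le_div_of_nonneg_right
      (mul_le_mul_of_nonneg_left (h1.trans h2) (by linarith)) h3.le
  linarith

/-- The weighted bound improves itself, by the Lipschitz continuity of the nonlinearity. -/
theorem norm_weightedDiff_le_of_forall_le (hu₁ : E.IsSolution γ F g T u₁)
    (hu₂ : E.IsSolution γ F g T u₂) (hF : Continuous F) {M : ℝ} (hM : ∀ x, ‖F x‖ ≤ M) {L : ℝ}
    (hL0 : 0 ≤ L) (hL : ∀ x y, ‖F x - F y‖ ≤ L * ‖x - y‖) {q a ρ : ℝ} (hγ : 0 ≤ γ) (hq0 : 0 ≤ q)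
    (ha : 0 < a) (ha1 : a < 1) (hq : q + γ = (1 + γ) * a) (hρ : 0 < ρ)
    (hρ2 : L * E.lam 0 ^ (-q) * ρ ^ (-((1 - a) / 2)) * (3 / (1 - (1 + a) / 2)) ≤ 1 / 2)
    {B : ℝ} (hB : 0 ≤ B)
    (hle : ∀ t, 0 < t → t ≤ 1 → t ≤ T → ∀ S,
      ‖E.weightedDiff q (E.coeff (u₁ t)) (E.coeff (u₂ t)) S‖
        ≤ B * (t ^ (-a) * Real.exp (ρ * t)))
    {t : ℝ} (ht : 0 < t) (ht1 : t ≤ 1) (htT : t ≤ T) (S : Finset ℕ) :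
    ‖E.weightedDiff q (E.coeff (u₁ t)) (E.coeff (u₂ t)) S‖
      ≤ (E.lam 0 ^ (-(γ / 2)) * ‖u₁ 0 - u₂ 0‖ + B / 2) * (t ^ (-a) * Real.exp (ρ * t)) := by
  have hl := E.lam_pos 0
  set b := (1 + a) / 2 with hb
  set δ := ρ ^ (-((1 - a) / 2)) with hδ
  set κ := E.lam 0 ^ (-q) with hκ
  have hκ0 : 0 < κ := Real.rpow_pos_of_pos hl _
  have hδ0 : 0 < δ := Real.rpow_pos_of_pos hρ _
  have hb1 : b < 1 := by rw [hb]; linarith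
  set Q := t ^ (-a) * Real.exp (ρ * t) with hQ
  have hQ0 : 0 < Q := by positivity
  have hi1 := integrableOn_rpow_neg hb1 t
  have hi2 := (integrableOn_sub_rpow_neg hb1 ht.le).const_mul 2
  have h := hu₁.norm_weightedDiff_le hu₂ hF hM hγ ha.le ha1.le hq ht htT S
    (Φ := fun s => L * κ * B * Q * δ * (s ^ (-b) + 2 * (t - s) ^ (-b)))
    ((hi1.add hi2).const_mul _) (by
      have hmono : volume.restrict (Ioo 0 t) ≤ volume.restrict (Ioo 0 T) :=
        Measure.restrict_mono (Ioo_subset_Ioo_right htT) le_rfl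
      filter_upwards [ae_restrict_mem measurableSet_Ioo, ae_mono hmono hu₁.ae_memℓp,
        ae_mono hmono hu₂.ae_memℓp] with s hs h₁ h₂
      have hτ : 0 < t - s := sub_pos.2 hs.2
      have e1 : ‖E.toH (E.coeff (u₁ s)) - E.toH (E.coeff (u₂ s))‖
          ≤ κ * (B * (s ^ (-a) * Real.exp (ρ * s))) :=
        E.norm_toH_sub_le h₁ h₂ fun S => (E.norm_sum_sub_le hq0 _ _ S).trans
          (mul_le_mul_of_nonneg_left (hle s hs.1 (hs.2.le.trans ht1) (hs.2.le.trans htT) S) hκ0.le)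
      have e2 := add_rpow_mul_rpow_mul_exp_le ha ha1 hs.1 hτ hρ
      rw [add_sub_cancel] at e2
      have e3 : t ^ (-a) * t ^ a = 1 := by rw [← Real.rpow_add ht]; simp
      have e4 : Real.exp (ρ * t) * Real.exp (-ρ * (t - s)) = Real.exp (ρ * s) := by
        rw [← Real.exp_add]; congr 1; ring
      rw [norm_sub_rev] at e1
      -- Pulling the target weight `Q` out of the integrand leaves the kernel of
      -- `add_rpow_mul_rpow_mul_exp_le` with τ = t - s.
      calc (t - s) ^ (-a) * ‖F (E.toH (E.coeff (u₂ s))) - F (E.toH (E.coeff (u₁ s)))‖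
          ≤ (t - s) ^ (-a) * (L * (κ * (B * (s ^ (-a) * Real.exp (ρ * s))))) := by
            gcongr
            exact (hL _ _).trans (mul_le_mul_of_nonneg_left e1 hL0)
        _ = L * κ * B * Q * (t ^ a * (t - s) ^ (-a) * s ^ (-a) * Real.exp (-ρ * (t - s))) := by
            rw [hQ, ← e4]
            linear_combination -((t - s) ^ (-a) * (L * (κ * (B * (s ^ (-a) *
              (Real.exp (ρ * t) * Real.exp (-ρ * (t - s)))))))) * e3
        _ ≤ L * κ * B * Q * (δ * (s ^ (-b) + 2 * (t - s) ^ (-b))) := by gcongr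
        _ = _ := by ring)
  rw [integral_const_mul, integral_add hi1 hi2, integral_const_mul, integral_rpow_neg hb1 ht.le,
    integral_sub_rpow_neg hb1 ht.le] at h
  have h1 : t ^ (1 - b) ≤ 1 := Real.rpow_le_one ht.le ht1 (by linarith)
  have h3 : 0 < 1 - b := by linarith
  have h4 : t ^ (1 - b) / (1 - b) + 2 * (t ^ (1 - b) / (1 - b)) ≤ 3 / (1 - b) := by
    rw [show t ^ (1 - b) / (1 - b) + 2 * (t ^ (1 - b) / (1 - b)) = 3 * t ^ (1 - b) / (1 - b) by
      ring]
    gcongr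
    linarith
  have h5 : L * κ * B * Q * δ * (t ^ (1 - b) / (1 - b) + 2 * (t ^ (1 - b) / (1 - b)))
      ≤ B / 2 * Q := by
    calc _ ≤ L * κ * B * Q * δ * (3 / (1 - b)) := by gcongr
      _ = B * Q * (L * κ * δ * (3 / (1 - b))) := by ring
      _ ≤ B * Q * (1 / 2) := by gcongr
      _ = B / 2 * Q := by ring
  have h6 : t ^ (-a) ≤ Q := le_mul_of_one_le_right (by positivity) (Real.one_le_exp (by positivity))
  have h7 : t ^ (-a) * E.lam 0 ^ (-(γ / 2)) * ‖u₁ 0 - u₂ 0‖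
      ≤ E.lam 0 ^ (-(γ / 2)) * ‖u₁ 0 - u₂ 0‖ * Q := by
    rw [mul_assoc, mul_comm]
    gcongr
  linarith

end IsSolution

theorem exists_norm_weightedDiff_le (E : EigenBasis A) (hγ : 0 ≤ γ)
    (hbound : ∃ M : ℝ, ∀ u : H, ‖F u‖ ≤ M)
    (hlip : ∃ L : ℝ, ∀ u₁ u₂ : H, ‖F u₁ - F u₂‖ ≤ L * ‖u₁ - u₂‖) (g : H) {q : ℝ} (hq0 : 0 < q)
    (hq1 : q < 1) :
    ∃ C : ℝ, 0 < C ∧ ∀ (T : ℝ) (u₁ u₂ : ℝ → E.Hs (-γ)),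
      E.IsSolution γ F g T u₁ → E.IsSolution γ F g T u₂ →
      ∀ t : ℝ, 0 < t → t ≤ 1 → t ≤ T → ∀ S : Finset ℕ,
        ‖E.weightedDiff q (E.coeff (u₁ t)) (E.coeff (u₂ t)) S‖
          ≤ C * t⁻¹ * ‖u₁ 0 - u₂ 0‖ := by
  obtain ⟨M, hM⟩ := hbound
  obtain ⟨L, hL0, hL⟩ : ∃ L : ℝ, 0 ≤ L ∧ ∀ u₁ u₂ : H, ‖F u₁ - F u₂‖ ≤ L * ‖u₁ - u₂‖ := by
    obtain ⟨L, hL⟩ := hlip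
    exact ⟨|L|, abs_nonneg L, fun x y =>
      (hL x y).trans (mul_le_mul_of_nonneg_right (le_abs_self L) (norm_nonneg _))⟩
  have hM0 : 0 ≤ M := (norm_nonneg _).trans (hM 0)
  have hF : Continuous F :=
    (LipschitzWith.of_dist_le_mul (K := L.toNNReal) fun x y => by
      simpa only [dist_eq_norm, Real.coe_toNNReal L hL0] using hL x y).continuous
  have hl := E.lam_pos 0
  set a := (q + γ) / (1 + γ) with ha
  have ha0 : 0 < a := by positivity
  have ha1 : a < 1 := by rw [ha, div_lt_one (by positivity)]; linarith
  have hq : q + γ = (1 + γ) * a := by rw [ha]; field_simp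
  -- The factor 3/(1-b), b = (1+a)/2, bounds the integral of s^(-b) + 2(t-s)^(-b) for t ≤ 1. The
  -- choice of `ρ` involves neither the solutions nor `T`.
  obtain ⟨ρ, hρ2, hρ⟩ : ∃ ρ : ℝ, L * E.lam 0 ^ (-q) * ρ ^ (-((1 - a) / 2)) *
      (3 / (1 - (1 + a) / 2)) ≤ 1 / 2 ∧ 0 < ρ := by
    have hlim := ((tendsto_rpow_neg_atTop (y := (1 - a) / 2) (by linarith)).const_mul
      (L * E.lam 0 ^ (-q))).mul_const (3 / (1 - (1 + a) / 2))
    rw [mul_zero, zero_mul] at hlim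
    exact ((hlim.eventually_le_const (by norm_num)).and (Filter.eventually_gt_atTop 0)).exists
  refine ⟨2 * E.lam 0 ^ (-(γ / 2)) * Real.exp ρ, by positivity, ?_⟩
  intro T u₁ u₂ hu₁ hu₂ t ht ht1 htT S
  -- Times and finite index sets are iterated together, since improving the bound at t uses it at
  -- all earlier times and all `S`.
  have key := le_two_mul_of_forall_le_add_half
    (ι := {t : ℝ // 0 < t ∧ t ≤ 1 ∧ t ≤ T} × Finset ℕ)
    (N := fun i => ‖E.weightedDiff q (E.coeff (u₁ i.1)) (E.coeff (u₂ i.1)) i.2‖)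
    (φ := fun i => (i.1 : ℝ) ^ (-a) * Real.exp (ρ * i.1))
    (fun i => mul_nonneg (Real.rpow_nonneg i.1.2.1.le _) (Real.exp_pos _).le)
    (m := E.lam 0 ^ (-(γ / 2)) * ‖u₁ 0 - u₂ 0‖)
    (B₀ := E.lam 0 ^ (-(γ / 2)) * ‖u₁ 0 - u₂ 0‖ + 2 * M / (1 - a)) (by positivity)
    (add_nonneg (by positivity) (div_nonneg (by linarith) (by linarith)))
    (fun i => by
      obtain ⟨⟨r, hr, hr1, hrT⟩, S⟩ := i
      refine (hu₁.norm_weightedDiff_le_of_bound hu₂ hF hM hγ ha0.le ha1 hq hr hr1 hrT S).trans ?_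
      refine mul_le_mul_of_nonneg_left ?_
        (add_nonneg (by positivity) (div_nonneg (by linarith) (by linarith)))
      exact le_mul_of_one_le_right (by positivity) (Real.one_le_exp (by positivity)))
    (fun B hB hle i => hu₁.norm_weightedDiff_le_of_forall_le hu₂ hF hM hL0 hL hγ hq0.le ha0 ha1
      hq hρ hρ2 hB (fun r hr hr1 hrT S => hle ⟨⟨r, hr, hr1, hrT⟩, S⟩) i.1.2.1 i.1.2.2.1 i.1.2.2.2
      i.2) ⟨⟨t, ht, ht1, htT⟩, S⟩
  refine key.trans ?_
  have h1 : t ^ (-a) ≤ t⁻¹ := by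
    rw [← Real.rpow_neg_one]
    exact Real.rpow_le_rpow_of_exponent_ge ht ht1 (by linarith)
  have h2 : Real.exp (ρ * t) ≤ Real.exp ρ := Real.exp_le_exp.2 (mul_le_of_le_one_right hρ.le ht1)
  calc 2 * (E.lam 0 ^ (-(γ / 2)) * ‖u₁ 0 - u₂ 0‖) * (t ^ (-a) * Real.exp (ρ * t))
      ≤ 2 * (E.lam 0 ^ (-(γ / 2)) * ‖u₁ 0 - u₂ 0‖) * (t⁻¹ * Real.exp ρ) := by gcongr
    _ = _ := by ring

end EigenBasis

/-! ### The main theorem. -/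

theorem proposition1p2 {H : Type*} [NormedAddCommGroup H] [InnerProductSpace ℝ H]
    [CompleteSpace H] (A : PosOperator H) (E : EigenBasis A) (γ : ℝ) (hγ : 0 ≤ γ)
    (F : H → H) (hbound : ∃ M : ℝ, ∀ u : H, ‖F u‖ ≤ M)
    (hlip : ∃ L : ℝ, ∀ u₁ u₂ : H, ‖F u₁ - F u₂‖ ≤ L * ‖u₁ - u₂‖)
    (g : H) (β : ℝ) (hβ : 0 < β) :
    ∃ C : ℝ, 0 < C ∧ ∀ (T : ℝ) (u₁ u₂ : ℝ → E.Hs (-γ)), 0 < T →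
      E.IsSolution γ F g T u₁ → E.IsSolution γ F g T u₂ →
      ∀ t : ℝ, 0 < t → t ≤ 1 → t ≤ T →
        ∃ d : E.Hs (2 - β), E.coeff d = E.coeff (u₁ t) - E.coeff (u₂ t) ∧
          ‖d‖ ≤ C * t⁻¹ * ‖u₁ 0 - u₂ 0‖ := by
  have hl := E.lam_pos 0
  have hmin : 0 < min β 1 := lt_min hβ one_pos
  have hmin1 : min β 1 ≤ 1 := min_le_right _ _
  -- The minimum keeps `q` in [1/2, 1) for large `β`; the surplus `p` of the weight over (2-β)/2 is
  -- nonnegative and costs only λ₀^(-p).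
  set q := 1 - min β 1 / 2 with hq
  obtain ⟨C, hC, h⟩ := E.exists_norm_weightedDiff_le hγ hbound hlip g (q := q)
    (by rw [hq]; linarith) (by rw [hq]; linarith)
  set p := q - (2 - β) / 2 with hp
  have hp0 : 0 ≤ p := by
    have := min_le_left β 1
    rw [hp, hq]; linarith
  refine ⟨E.lam 0 ^ (-p) * C, by positivity, ?_⟩
  intro T u₁ u₂ _ hu₁ hu₂ t ht ht1 htT
  refine E.exists_of_sum_sq_le (by positivity) fun S => ?_
  rw [← E.e.norm_sum_smul_sq]
  refine pow_le_pow_left₀ (norm_nonneg _) ?_ 2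
  rw [mul_assoc (E.lam 0 ^ (-p)), mul_assoc]
  have hS := h T u₁ u₂ hu₁ hu₂ t ht ht1 htT S
  refine E.e.norm_sum_smul_le (b := fun n => E.lam n ^ q * (E.coeff (u₁ t) n - E.coeff (u₂ t) n))
    (by positivity) (by positivity) (fun n _ => ?_) ?_
  · have hln := E.lam_pos n
    rw [abs_mul, abs_mul, abs_of_pos (Real.rpow_pos_of_pos hln _),
      abs_of_pos (Real.rpow_pos_of_pos hln _), ← mul_assoc]
    refine mul_le_mul_of_nonneg_right ?_ (abs_nonneg _)
    have h1 : E.lam 0 ^ p ≤ E.lam n ^ p := Real.rpow_le_rpow hl.le (E.mono (Nat.zero_le n)) hp0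
    rw [Real.rpow_neg hl.le, inv_mul_eq_div, le_div_iff₀ (by positivity),
      show q = (2 - β) / 2 + p by rw [hp]; ring, Real.rpow_add hln]
    gcongr
  · rw [← E.e.norm_sum_smul_sq]
    refine pow_le_pow_left₀ (norm_nonneg _) ?_ 2
    exact hS
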